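/- Let $H$ be a complex Hilbert space and let $P(H)\subset B(H)$ be the set of positive invertible bounded operators on $H$. For $x,y\in P(H)$ and $t\in[0,1]$ put $$d(x,y)=\bigl\|\ln\bigl(x^{-1/2}yx^{-1/2}\bigr)\bigr\|,\qquad \eta(x,y,t)=x^{1/2}\bigl(x^{-1/2}yx^{-1/2}\bigr)^{t}x^{1/2}\in P(H).$$ Then the following hold. (1) $(P(H),d)$ together with $\eta$ is a GCB-space. That is, $d$ is a complete metric on $P(H)$; $\eta$ is a geodesic bicombing, i.e. for all $x,y\in P(H)$ and $s,t\in[0,1]$ the curve $\eta(x,y,\cdot)$ is a geodesic from $x$ to $y$ (a $d$-continuous curve from $x$ to $y$ of length $d(x,y)$), $\eta(y,x,t)=\eta(x,y,1-t)$, $\eta(x,\eta(x,y,t),s)=\eta(x,y,ts)$, and $\eta(x_n,y_n,t)\to\eta(x,y,t)$ in $d$ whenever $x_n\to x$ and $y_n\to y$ in $d$; and $d$ is convex along $\eta$: $$d\bigl(\eta(x_1,x_2,t),\eta(y_1,y_2,t)\bigr)\le t\,d(x_2,y_2)+(1-t)\,d(x_1,y_1)$$ for all $x_1,x_2,y_1,y_2\in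 P(H)$ and $t\in[0,1]$. (2) For every invertible $A\in B(H)$ the map $f_A:x\mapsto A^*xA$ is a bijective isometry of $(P(H),d)$ which respects the bicombing, i.e. $f_A(\eta(x,y,t))=\eta(f_A(x),f_A(y),t)$ for all $x,y,t$. (3) $P(H)$ has property (C) when only isometries of the form $f_A:x\mapsto A^*xA$ with $A\in B(H)$ are considered. That is, let $(x_n)_{n\in\mathbb N}$ be a $d$-bounded sequence in $P(H)$ and let $\mathcal F$ be any family of isometries of $(P(H),d)$ into itself that respect the bicombing and are of the form $f_A$ with $A\in B(H)$, such that $d(x_n,f(x_n))\to0$ for every $f\in\mathcal F$. Then there is $z\in P(H)$ which is convex close to the sequence, i.e. $d(z,x_m)\le\operatorname{diam}_d\{x_n: n\in\mathbb N\}$ for all $m$, and which satisfies $f(z)=z$ for all $f\in\mathcal F$. (4) Such fixed points are obtained as weak-operator limit points: in the situation of (3), the sequence $(x_n)$ has a limit point (cluster point) in $B(H)$ for the weak operator topology, and every such limit point lies in $P(H)$, is convex close to $(x_n)$, and is fixed by every $f\in\mathcal F$. -/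

import Mathlib

open Filter Topology

/-! ### Metric spaces with a geodesic bicombing -/

section Bicombing

variable {X : Type*} [MetricSpace X]

/-- A geodesic from `x` to `y`: a continuous curve of length `dist x y` joining `x` to `y`. -/
def IsGeodesicCurve (γ : unitInterval → X) (x y : X) : Prop :=
  Continuous γ ∧ γ 0 = x ∧ γ 1 = y ∧ eVariationOn γ Set.univ = ENNReal.ofReal (dist x y)

/-- A geodesic bicombing `η : X × X × [0,1] → X`.
`unitInterval.symm t` is `1 - t`. -/
structure IsGeodesicBicombing (η : X → X → unitInterval → X) : Prop where
  geodesic : ∀ x y, IsGeodesicCurve (η x y) x y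
  reverse : ∀ x y t, η y x t = η x y (unitInterval.symm t)
  restrict : ∀ x y t s, η x (η x y t) s = η x y (t * s)
  continuous : ∀ (t : unitInterval) (u v : ℕ → X) (x y : X),
    Tendsto u atTop (𝓝 x) → Tendsto v atTop (𝓝 y) →
      Tendsto (fun n => η (u n) (v n) t) atTop (𝓝 (η x y t))

/-- A GCB-space: a complete metric space with a geodesic bicombing along which the metric
is convex. -/
structure IsGCBSpace (η : X → X → unitInterval → X) : Prop where
  complete : CompleteSpace X
  bicombing : IsGeodesicBicombing η
  convex : ∀ (x₁ x₂ y₁ y₂ : X) (t : unitInterval),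
    dist (η x₁ x₂ t) (η y₁ y₂ t) ≤ (t : ℝ) * dist x₂ y₂ + (1 - (t : ℝ)) * dist x₁ y₁

/-- The map `f` respects the bicombing `η`. -/
def RespectsBicombing (η : X → X → unitInterval → X) (f : X → X) : Prop :=
  ∀ x y t, f (η x y t) = η (f x) (f y) t

/-- The point `z` is convex close to the (bounded) set `A`. -/
def IsConvexClose (z : X) (A : Set X) : Prop :=
  ∀ a ∈ A, dist z a ≤ Metric.diam A

/-- The hypotheses of property (C), for maps taken from the class `S`: `x` is a bounded sequence
and `F` a family of bicombing respecting isometries belonging to `S`, each of which moves `x n`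
by a distance tending to `0`. -/
structure IsAsymptoticallyFixed (η : X → X → unitInterval → X) (S : Set (X → X))
    (x : ℕ → X) (F : Set (X → X)) : Prop where
  bounded : Bornology.IsBounded (Set.range x)
  mem : ∀ f ∈ F, f ∈ S
  isometry : ∀ f ∈ F, Isometry f
  respects : ∀ f ∈ F, RespectsBicombing η f
  tendsto : ∀ f ∈ F, Tendsto (fun n => dist (x n) (f (x n))) atTop (𝓝 0)

/-- Property (C) when considering only isometries from the class `S`. -/
def HasPropertyC (η : X → X → unitInterval → X) (S : Set (X → X)) : Prop :=
  ∀ (x : ℕ → X) (F : Set (X → X)), IsAsymptoticallyFixed η S x F →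
    ∃ z : X, IsConvexClose z (Set.range x) ∧ ∀ f ∈ F, f z = z

end Bicombing

/-! ### The cone of positive invertible operators -/

/-- The cone `P(H)` of positive invertible bounded operators on `H`. (A structure of its own, so
that it does not inherit the norm metric of `B(H)`.) -/
@[ext]
structure PosInv (H : Type*) [NormedAddCommGroup H] [InnerProductSpace ℂ H] [CompleteSpace H] where
  /-- the underlying operator -/
  val : H →L[ℂ] H
  pos : val.IsPositive
  isUnit : IsUnit val

namespace PosInv

variable {H : Type*} [NormedAddCommGroup H] [InnerProductSpace ℂ H] [CompleteSpace H]

theorem isStrictlyPositive (x : PosInv H) : IsStrictlyPositive x.val :=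
  ⟨(ContinuousLinearMap.nonneg_iff_isPositive _).2 x.pos, x.isUnit⟩

theorem isStrictlyPositive_conj {a b : H →L[ℂ] H} (ha : IsStrictlyPositive a)
    (hb : IsStrictlyPositive b) : IsStrictlyPositive (a * b * a) := by
  have hs : star a = a := (IsSelfAdjoint.of_nonneg ha.nonneg).star_eq
  refine ⟨?_, (ha.isUnit.mul hb.isUnit).mul ha.isUnit⟩
  have := star_left_conjugate_nonneg hb.nonneg a
  rwa [hs] at this

/-- The Thompson distance `‖ln (x^{-1/2} y x^{-1/2})‖`. -/
noncomputable def thompsonDist (x y : PosInv H) : ℝ :=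
  ‖CFC.log (x.val ^ (-(1 / 2) : ℝ) * y.val * x.val ^ (-(1 / 2) : ℝ))‖

/-- The curve `η(x,y,t) = x^{1/2} (x^{-1/2} y x^{-1/2})^t x^{1/2}`. -/
noncomputable def eta (x y : PosInv H) (t : unitInterval) : PosInv H :=
  have h : IsStrictlyPositive (x.val ^ (1 / 2 : ℝ) *
      (x.val ^ (-(1 / 2) : ℝ) * y.val * x.val ^ (-(1 / 2) : ℝ)) ^ (t : ℝ) *
      x.val ^ (1 / 2 : ℝ)) :=
    isStrictlyPositive_conj (.rpow _ _ x.isStrictlyPositive)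
      (.rpow _ _ (isStrictlyPositive_conj (.rpow _ _ x.isStrictlyPositive) y.isStrictlyPositive))
  { val := x.val ^ (1 / 2 : ℝ) *
      (x.val ^ (-(1 / 2) : ℝ) * y.val * x.val ^ (-(1 / 2) : ℝ)) ^ (t : ℝ) *
      x.val ^ (1 / 2 : ℝ)
    pos := (ContinuousLinearMap.nonneg_iff_isPositive _).1 h.nonneg
    isUnit := h.isUnit }

/-- The self-map `f` of `P(H)` is `f_A : x ↦ A* x A`. -/
def IsCongruenceBy (A : H →L[ℂ] H) (f : PosInv H → PosInv H) : Prop :=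
  ∀ x, (f x).val = ContinuousLinearMap.adjoint A * x.val * A

/-- The self-maps of `P(H)` of the form `x ↦ A* x A` with `A ∈ B(H)`. -/
def congruences (H : Type*) [NormedAddCommGroup H] [InnerProductSpace ℂ H] [CompleteSpace H] :
    Set (PosInv H → PosInv H) :=
  {f | ∃ A : H →L[ℂ] H, IsCongruenceBy A f}

/-- `T ∈ B(H)` is a limit (that is, cluster) point of the sequence `x` in the weak operator
topology. -/
def IsWOTLimitPoint (T : H →L[ℂ] H) (x : ℕ → PosInv H) : Prop :=
  MapClusterPt (ContinuousLinearMapWOT.ofCLM T) atTop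
    (fun n => ContinuousLinearMapWOT.ofCLM (x n).val)

end PosInv

/-!
For `r ≥ 0`, `d(x, y) ≤ r` means `x ≤ e^r y` and `y ≤ e^r x`. In this form it is clear that `d` is
a metric and that every congruence `f_A` with `A` invertible is an isometry. Polar decomposition of
`A` shows that `f_A` also respects `η`; as `x = A* A` with `A = x^{1/2}`, every identity for `η`
may be checked with the first point equal to `1`, where `η(1, y, t) = y^t`. There the Löwner–Heinz
inequality gives `d(y^t, z^t) ≤ t d(y, z)`, from which convexity of `d` along `η` follows.

A closed `d`-ball around `c` is the order interval `e^{-r} c ≤ T ≤ e^r c` of `B(H)`, hence compact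
for the weak operator topology, and the order characterization makes `d` lower semicontinuous for
that topology. So a `d`-bounded sequence has weak limit points in `P(H)`; such a point `z` lies in
every closed ball eventually containing the sequence, which gives completeness and convex closeness.
As `T ↦ A* T A` is weakly continuous, `(z, f_A(z))` is a limit point of the pairs `(x_n, f_A(x_n))`,
and hence `d(z, f_A(z)) = 0` when `d(x_n, f_A(x_n)) → 0`.
-/

open scoped NNReal InnerProductSpace

section CStarAlgebra

variable {A : Type*} [CStarAlgebra A] [PartialOrder A] [StarOrderedRing A] {a b : A}

theorem norm_cfcLog_le_iff (ha : IsStrictlyPositive a) {r : ℝ} (hr : 0 ≤ r) :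
    ‖CFC.log a‖ ≤ r ↔ 1 ≤ Real.exp r • a ∧ a ≤ Real.exp r • 1 := by
  have hlog : ContinuousOn Real.log (spectrum ℝ a) :=
    Real.continuousOn_log.mono fun x hx => (ha.spectrum_pos hx).ne'
  rw [← inv_smul_le_iff_of_pos (Real.exp_pos r), ← Real.exp_neg,
    ← Algebra.algebraMap_eq_smul_one, ← Algebra.algebraMap_eq_smul_one,
    algebraMap_le_iff_le_spectrum, le_algebraMap_iff_spectrum_le, CFC.log,
    norm_cfc_le_iff _ _ hr, ← forall₂_and]
  refine forall₂_congr fun x hx => ?_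
  rw [Real.norm_eq_abs, abs_le, Real.le_log_iff_exp_le (ha.spectrum_pos hx),
    Real.log_le_iff_le_exp (ha.spectrum_pos hx)]

theorem cfcLog_rpow (ha : IsStrictlyPositive a) (s : ℝ) : CFC.log (a ^ s) = s • CFC.log a := by
  have hlog : ContinuousOn Real.log (spectrum ℝ a) :=
    Real.continuousOn_log.mono fun x hx => (ha.spectrum_pos hx).ne'
  have hpow : ContinuousOn (fun x : ℝ => x ^ s) (spectrum ℝ a) :=
    continuousOn_id.rpow_const fun _ hx => .inl (ha.spectrum_pos hx).ne'
  have hlog' : ContinuousOn Real.log ((fun x : ℝ => x ^ s) '' spectrum ℝ a) := by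
    refine Real.continuousOn_log.mono ?_
    rintro _ ⟨x, hx, rfl⟩
    exact (Real.rpow_pos_of_pos (ha.spectrum_pos hx) s).ne'
  rw [CFC.log, CFC.rpow_eq_cfc_real ha.nonneg,
    ← cfc_comp' Real.log _ a hlog' hpow, CFC.log,
    ← cfc_smul s Real.log a hlog]
  exact cfc_congr fun x hx => Real.log_rpow (ha.spectrum_pos hx) s

theorem smul_rpow (ha : 0 ≤ a) {c s : ℝ} (hc : 0 ≤ c) (hs : 0 ≤ s) :
    (c • a) ^ s = c ^ s • a ^ s := by
  rw [CFC.rpow_eq_cfc_real (smul_nonneg hc ha), CFC.rpow_eq_cfc_real ha,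
    ← cfc_comp_smul c _ a (Real.continuous_rpow_const hs).continuousOn,
    ← cfc_smul (c ^ s) _ a (Real.continuous_rpow_const hs).continuousOn]
  exact cfc_congr fun x hx => Real.mul_rpow hc (spectrum_nonneg_of_nonneg ha hx)

theorem star_mul_mul_rpow_of_mem_unitary {u : A} (hu : u ∈ unitary A)
    (ha : IsStrictlyPositive a) (s : ℝ) : (star u * a * u) ^ s = star u * a ^ s * u := by
  have h := StarAlgHomClass.map_cfc (S := ℂ) (Unitary.conjStarAlgAut ℂ A (star ⟨u, hu⟩))
    (fun x : ℝ≥0 => x ^ s) a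
    (NNReal.continuousOn_rpow_const (.inl (spectrum.zero_notMem ℝ≥0 ha.isUnit)))
    (map_continuous _) ha.nonneg (map_nonneg _ ha.nonneg)
  simpa [CFC.rpow_def, Unitary.conjStarAlgAut_apply] using h.symm

theorem exists_unitary_mul_rpow_star_mul_self (ha : IsUnit a) :
    ∃ u ∈ unitary A, a = u * (star a * a) ^ (1 / 2 : ℝ) := by
  have hp : IsStrictlyPositive (star a * a) := ⟨star_mul_self_nonneg a, ha.star.mul ha⟩
  set q := (star a * a) ^ (-(1 / 2) : ℝ) with hq
  have hqsa : star q = q := (IsSelfAdjoint.of_nonneg CFC.rpow_nonneg).star_eq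
  have hunit : IsUnit (a * q) := ha.mul (IsStrictlyPositive.rpow _ _ hp).isUnit
  have hstar : star (a * q) * (a * q) = 1 := by
    rw [star_mul, hqsa, ← CFC.conjugate_rpow_neg_one_half (star a * a) hp]
    simp only [hq, mul_assoc]
  refine ⟨a * q, Unitary.mem_iff.2 ⟨hstar, hunit.mul_right_cancel ?_⟩, ?_⟩
  · rw [mul_assoc, hstar, mul_one, one_mul]
  · rw [mul_assoc, hq, CFC.rpow_neg_mul_rpow _ hp, mul_one]

end CStarAlgebra

theorem star_mul_mul_le_star_mul_mul_iff {R : Type*} [Ring R] [StarRing R] [PartialOrder R]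
    [StarOrderedRing R] {a b c : R} (hc : IsUnit c) :
    star c * a * c ≤ star c * b * c ↔ a ≤ b := by
  rw [← sub_nonneg, ← sub_mul, ← mul_sub, hc.star_left_conjugate_nonneg_iff, sub_nonneg]

namespace PosInv

variable {H : Type*} [NormedAddCommGroup H] [InnerProductSpace ℂ H] [CompleteSpace H]

/-- A strictly positive operator, in the sense of `C⋆`-algebras, as a point of `P(H)`. -/
def ofIsStrictlyPositive (a : H →L[ℂ] H) (ha : IsStrictlyPositive a) : PosInv H where
  val := a
  pos := (ContinuousLinearMap.nonneg_iff_isPositive _).1 ha.nonneg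
  isUnit := ha.isUnit

theorem nonneg (x : PosInv H) : 0 ≤ x.val := x.isStrictlyPositive.nonneg

theorem thompsonDist_le_iff {x y : PosInv H} {r : ℝ} (hr : 0 ≤ r) :
    thompsonDist x y ≤ r ↔ x.val ≤ Real.exp r • y.val ∧ y.val ≤ Real.exp r • x.val := by
  set c := x.val ^ (-(1 / 2) : ℝ) with hc
  have hcpos : IsStrictlyPositive c := .rpow _ _ x.isStrictlyPositive
  have hcx : c * x.val * c = 1 := CFC.conjugate_rpow_neg_one_half x.val x.isStrictlyPositive
  have hconj (a b : H →L[ℂ] H) : c * a * c ≤ c * b * c ↔ a ≤ b := by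
    simpa only [(IsSelfAdjoint.of_nonneg hcpos.nonneg).star_eq] using
      star_mul_mul_le_star_mul_mul_iff hcpos.isUnit (a := a) (b := b)
  rw [thompsonDist, ← hc,
    norm_cfcLog_le_iff (isStrictlyPositive_conj hcpos y.isStrictlyPositive) hr,
    ← hconj x.val, ← hconj y.val]
  simp only [mul_smul_comm, smul_mul_assoc, hcx]

theorem thompsonDist_nonneg (x y : PosInv H) : 0 ≤ thompsonDist x y := norm_nonneg _

theorem val_le_exp_thompsonDist_smul (x y : PosInv H) :
    x.val ≤ Real.exp (thompsonDist x y) • y.val ∧ y.val ≤ Real.exp (thompsonDist x y) • x.val :=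
  (thompsonDist_le_iff (thompsonDist_nonneg x y)).1 le_rfl

theorem thompsonDist_comm_le (x y : PosInv H) : thompsonDist x y ≤ thompsonDist y x :=
  (thompsonDist_le_iff (thompsonDist_nonneg y x)).2 (val_le_exp_thompsonDist_smul y x).symm

theorem thompsonDist_triangle (x y z : PosInv H) :
    thompsonDist x z ≤ thompsonDist x y + thompsonDist y z := by
  have trans_smul {a b c : H →L[ℂ] H} {r s : ℝ} (hab : a ≤ Real.exp r • b)
      (hbc : b ≤ Real.exp s • c) : a ≤ Real.exp (r + s) • c := by
    rw [Real.exp_add, mul_smul]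
    exact hab.trans (smul_le_smul_of_nonneg_left hbc (Real.exp_pos r).le)
  obtain ⟨hxy, hyx⟩ := val_le_exp_thompsonDist_smul x y
  obtain ⟨hyz, hzy⟩ := val_le_exp_thompsonDist_smul y z
  rw [thompsonDist_le_iff (add_nonneg (thompsonDist_nonneg x y) (thompsonDist_nonneg y z))]
  exact ⟨trans_smul hxy hyz, add_comm (thompsonDist x y) _ ▸ trans_smul hzy hyx⟩

/-- The Thompson metric on `P(H)`. -/
noncomputable instance : MetricSpace (PosInv H) where
  dist := thompsonDist
  dist_self x := le_antisymm ((thompsonDist_le_iff le_rfl).2 (by simp)) (thompsonDist_nonneg x x)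
  dist_comm x y := le_antisymm (thompsonDist_comm_le x y) (thompsonDist_comm_le y x)
  dist_triangle := thompsonDist_triangle
  eq_of_dist_eq_zero {x y} h := by
    obtain ⟨hxy, hyx⟩ := (thompsonDist_le_iff le_rfl).1 h.le
    rw [Real.exp_zero, one_smul] at hxy hyx
    exact PosInv.ext (le_antisymm hxy hyx)

theorem dist_le_iff {x y : PosInv H} {r : ℝ} (hr : 0 ≤ r) :
    dist x y ≤ r ↔ x.val ≤ Real.exp r • y.val ∧ y.val ≤ Real.exp r • x.val :=
  thompsonDist_le_iff hr

/-- The congruence `f_A : x ↦ A* x A` of `P(H)` by an invertible operator `A`. -/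
noncomputable def congruence (A : (H →L[ℂ] H)ˣ) (x : PosInv H) : PosInv H :=
  ofIsStrictlyPositive (star (A : H →L[ℂ] H) * x.val * A)
    (A.isUnit.isStrictlyPositive_star_left_conjugate_iff.2 x.isStrictlyPositive)

theorem val_congruence (A : (H →L[ℂ] H)ˣ) (x : PosInv H) :
    (congruence A x).val = star (A : H →L[ℂ] H) * x.val * A := rfl

theorem congruence_congruence (A B : (H →L[ℂ] H)ˣ) (x : PosInv H) :
    congruence A (congruence B x) = congruence (B * A) x := by
  ext1
  simp only [val_congruence, Units.val_mul, star_mul, mul_assoc]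

theorem congruence_one_apply (x : PosInv H) : congruence 1 x = x := by
  ext1
  simp only [val_congruence, Units.val_one, star_one, one_mul, mul_one]

theorem val_congruence_le_smul_iff (A : (H →L[ℂ] H)ˣ) (x y : PosInv H) (c : ℝ) :
    (congruence A x).val ≤ c • (congruence A y).val ↔ x.val ≤ c • y.val := by
  rw [val_congruence, val_congruence, ← smul_mul_assoc, ← mul_smul_comm,
    star_mul_mul_le_star_mul_mul_iff A.isUnit]

theorem isometry_congruence (A : (H →L[ℂ] H)ˣ) : Isometry (congruence A) := by
  refine Isometry.of_dist_eq fun x y => eq_of_forall_ge_iff fun r => ?_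
  rcases lt_or_ge r 0 with hr | hr
  · exact iff_of_false (hr.trans_le dist_nonneg).not_ge (hr.trans_le dist_nonneg).not_ge
  · simp only [dist_le_iff hr, val_congruence_le_smul_iff]

/-- The congruence `f_A`, as a bijective isometry of `P(H)` with inverse `f_{A⁻¹}`. -/
noncomputable def congruenceEquiv (A : (H →L[ℂ] H)ˣ) : PosInv H ≃ᵢ PosInv H where
  toFun := congruence A
  invFun := congruence A⁻¹
  left_inv x := by rw [congruence_congruence, mul_inv_cancel, congruence_one_apply]
  right_inv x := by rw [congruence_congruence, inv_mul_cancel, congruence_one_apply]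
  isometry_toFun := isometry_congruence A

/-- The base point of `P(H)`: the identity operator. -/
noncomputable instance : One (PosInv H) := ⟨ofIsStrictlyPositive 1 isStrictlyPositive_one⟩

theorem val_one : (1 : PosInv H).val = 1 := rfl

/-- The real power `x ^ s` in `P(H)`; `s ↦ rpow x s` is the geodesic line through `1` and `x`. -/
noncomputable def rpow (x : PosInv H) (s : ℝ) : PosInv H :=
  ofIsStrictlyPositive (x.val ^ s) (.rpow _ _ x.isStrictlyPositive)

theorem val_rpow (x : PosInv H) (s : ℝ) : (rpow x s).val = x.val ^ s := rfl

theorem rpow_zero (x : PosInv H) : rpow x 0 = 1 :=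
  PosInv.ext (CFC.rpow_zero _ x.nonneg)

theorem rpow_one (x : PosInv H) : rpow x 1 = x :=
  PosInv.ext (CFC.rpow_one _ x.nonneg)

theorem rpow_rpow (x : PosInv H) (s t : ℝ) : rpow (rpow x s) t = rpow x (s * t) := by
  rcases eq_or_ne s 0 with rfl | hs
  · rw [zero_mul, rpow_zero, PosInv.ext_iff, val_rpow, val_one, CFC.one_rpow]
  · exact PosInv.ext (CFC.rpow_rpow _ _ _ hs x.isStrictlyPositive)

theorem congruence_rpow (x : PosInv H) (r s : ℝ) :
    congruence (rpow x r).isUnit.unit (rpow x s) = rpow x (r + s + r) := by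
  ext1
  rw [val_congruence, IsUnit.unit_spec, (IsSelfAdjoint.of_nonneg (rpow x r).nonneg).star_eq]
  simp only [val_rpow, CFC.rpow_add x.isUnit]

theorem congruence_rpow_half_one (x : PosInv H) :
    congruence (rpow x (1 / 2)).isUnit.unit 1 = x := by
  rw [← rpow_zero x, congruence_rpow, add_zero, add_halves, rpow_one]

theorem exists_congruence_one_eq_and_congruence_eq (x y : PosInv H) :
    ∃ A z, congruence A 1 = x ∧ congruence A z = y :=
  ⟨_, _, congruence_rpow_half_one x, (congruenceEquiv _).apply_symm_apply y⟩

theorem dist_one_left (x : PosInv H) : dist 1 x = ‖CFC.log x.val‖ := by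
  change thompsonDist 1 x = _
  rw [thompsonDist, val_one, CFC.one_rpow, one_mul, mul_one]

theorem dist_rpow_rpow (x : PosInv H) (s t : ℝ) :
    dist (rpow x s) (rpow x t) = |t - s| * dist 1 x := by
  rw [← (isometry_congruence (rpow x (-s / 2)).isUnit.unit).dist_eq, congruence_rpow,
    congruence_rpow, show -s / 2 + s + -s / 2 = 0 by ring, rpow_zero,
    show -s / 2 + t + -s / 2 = t - s by ring, dist_one_left, dist_one_left, val_rpow,
    cfcLog_rpow x.isStrictlyPositive, norm_smul, Real.norm_eq_abs]

theorem dist_rpow_le (x y : PosInv H) {t : ℝ} (ht : t ∈ Set.Icc 0 1) :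
    dist (rpow x t) (rpow y t) ≤ t * dist x y := by
  have rpow_le {x y : PosInv H} (h : x.val ≤ Real.exp (dist x y) • y.val) :
      x.val ^ t ≤ Real.exp (t * dist x y) • y.val ^ t := by
    rw [mul_comm, Real.exp_mul, ← smul_rpow y.nonneg (Real.exp_pos _).le ht.1]
    exact CFC.rpow_le_rpow ht h
  obtain ⟨hxy, hyx⟩ := (dist_le_iff dist_nonneg).1 (le_refl (dist x y))
  rw [dist_le_iff (mul_nonneg ht.1 dist_nonneg)]
  exact ⟨rpow_le hxy, dist_comm x y ▸ rpow_le (dist_comm x y ▸ hyx)⟩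

/-- `A = U w^{1/2}` with `w = A* A`, so `w^{-1/2} (A* y A) w^{-1/2} = U* y U`. -/
theorem eta_congruence_one (A : (H →L[ℂ] H)ˣ) (y : PosInv H) (t : unitInterval) :
    eta (congruence A 1) (congruence A y) t = congruence A (rpow y t) := by
  obtain ⟨u, hu, hA⟩ := exists_unitary_mul_rpow_star_mul_self A.isUnit
  set w := star (A : H →L[ℂ] H) * A
  have hwpos : IsStrictlyPositive w := by
    simpa only [val_congruence, val_one, mul_one] using (congruence A 1).isStrictlyPositive
  have hpq : w ^ (1 / 2 : ℝ) * w ^ (-(1 / 2) : ℝ) = 1 := CFC.rpow_mul_rpow_neg _ hwpos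
  have hqp : w ^ (-(1 / 2) : ℝ) * w ^ (1 / 2 : ℝ) = 1 := CFC.rpow_neg_mul_rpow _ hwpos
  have hstarA : star (A : H →L[ℂ] H) = w ^ (1 / 2 : ℝ) * star u := by
    rw [hA, star_mul, (IsSelfAdjoint.of_nonneg CFC.rpow_nonneg).star_eq]
  have hconj : w ^ (-(1 / 2) : ℝ) * (congruence A y).val * w ^ (-(1 / 2) : ℝ) =
      star u * y.val * u := by
    rw [val_congruence, hstarA, hA]
    calc _ = w ^ (-(1 / 2) : ℝ) * w ^ (1 / 2 : ℝ) * (star u * y.val * u) *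
          (w ^ (1 / 2 : ℝ) * w ^ (-(1 / 2) : ℝ)) := by simp only [mul_assoc]
      _ = star u * y.val * u := by rw [hqp, hpq, one_mul, mul_one]
  have hval : (congruence A 1).val = w := by rw [val_congruence, val_one, mul_one]
  ext1
  calc (eta (congruence A 1) (congruence A y) t).val
      = w ^ (1 / 2 : ℝ) * (star u * y.val * u) ^ (t : ℝ) * w ^ (1 / 2 : ℝ) := by
        rw [← hconj, ← hval]; rfl
    _ = w ^ (1 / 2 : ℝ) * star u * y.val ^ (t : ℝ) * (u * w ^ (1 / 2 : ℝ)) := by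
        rw [star_mul_mul_rpow_of_mem_unitary hu y.isStrictlyPositive]
        simp only [mul_assoc]
    _ = (congruence A (rpow y t)).val := by
        rw [← hstarA, ← hA]; rfl

theorem eta_congruence (A : (H →L[ℂ] H)ˣ) (x y : PosInv H) (t : unitInterval) :
    eta (congruence A x) (congruence A y) t = congruence A (eta x y t) := by
  obtain ⟨B, z, rfl, rfl⟩ := exists_congruence_one_eq_and_congruence_eq x y
  simp only [congruence_congruence, eta_congruence_one]

theorem eta_one_right (x : PosInv H) (t : unitInterval) : eta x 1 t = rpow x (1 - t) := by
  have h1 : congruence (rpow x (1 / 2)).isUnit.unit (rpow x (-1)) = 1 := by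
    rw [congruence_rpow, ← rpow_zero x]
    norm_num
  calc eta x 1 t = congruence (rpow x (1 / 2)).isUnit.unit (rpow (rpow x (-1)) t) := by
        rw [← eta_congruence_one, congruence_rpow_half_one, h1]
    _ = rpow x (1 - t) := by
        rw [rpow_rpow, congruence_rpow]
        ring_nf

theorem eta_zero (x y : PosInv H) : eta x y 0 = x := by
  obtain ⟨A, z, rfl, rfl⟩ := exists_congruence_one_eq_and_congruence_eq x y
  rw [eta_congruence_one, Set.Icc.coe_zero, rpow_zero]

theorem eta_one (x y : PosInv H) : eta x y 1 = y := by
  obtain ⟨A, z, rfl, rfl⟩ := exists_congruence_one_eq_and_congruence_eq x y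
  rw [eta_congruence_one, Set.Icc.coe_one, rpow_one]

theorem eta_symm (x y : PosInv H) (t : unitInterval) :
    eta y x t = eta x y (unitInterval.symm t) := by
  obtain ⟨A, z, rfl, rfl⟩ := exists_congruence_one_eq_and_congruence_eq x y
  rw [eta_congruence, eta_one_right, eta_congruence_one, unitInterval.coe_symm_eq]

theorem eta_eta (x y : PosInv H) (t s : unitInterval) :
    eta x (eta x y t) s = eta x y (t * s) := by
  obtain ⟨A, z, rfl, rfl⟩ := exists_congruence_one_eq_and_congruence_eq x y
  simp only [eta_congruence_one, rpow_rpow, Set.Icc.coe_mul]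

theorem dist_eta_eta (x y : PosInv H) (s t : unitInterval) :
    dist (eta x y s) (eta x y t) = |(t : ℝ) - s| * dist x y := by
  obtain ⟨A, z, rfl, rfl⟩ := exists_congruence_one_eq_and_congruence_eq x y
  simp only [eta_congruence_one, (isometry_congruence A).dist_eq, dist_rpow_rpow]

theorem dist_eta_right_le (x y z : PosInv H) (t : unitInterval) :
    dist (eta x y t) (eta x z t) ≤ t * dist y z := by
  obtain ⟨A, y, rfl, rfl⟩ := exists_congruence_one_eq_and_congruence_eq x y
  obtain ⟨z, rfl⟩ := (congruenceEquiv A).surjective z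
  change dist (eta _ _ t) (eta _ (congruence A z) t) ≤ t * dist _ (congruence A z)
  simpa only [eta_congruence_one, (isometry_congruence A).dist_eq] using dist_rpow_le y z t.2

end PosInv

section Bicombing

variable {X : Type*} [MetricSpace X]

theorem isGeodesicCurve_of_dist_eq {γ : unitInterval → X} {x y : X} (h₀ : γ 0 = x) (h₁ : γ 1 = y)
    (h : ∀ s t : unitInterval, dist (γ s) (γ t) = |(t : ℝ) - s| * dist x y) :
    IsGeodesicCurve γ x y := by
  have hlip : LipschitzWith (nndist x y) γ := .of_dist_le_mul fun s t => by
    rw [h, mul_comm, abs_sub_comm, coe_nndist, Subtype.dist_eq, Real.dist_eq]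
  refine ⟨hlip.continuous, h₀, h₁, le_antisymm ?_ ?_⟩
  · have hvar : eVariationOn (id : unitInterval → unitInterval) Set.univ = 1 := by
      change eVariationOn ((↑) : unitInterval → ℝ) Set.univ = 1
      simpa [show Set.Icc (0 : unitInterval) 1 = Set.univ from Set.Icc_bot_top] using
        ((Subtype.mono_coe _).monotoneOn Set.univ).eVariationOn_eq
          (Set.mem_univ (0 : unitInterval)) (Set.mem_univ 1)
    calc eVariationOn γ Set.univ
        ≤ nndist x y * eVariationOn (id : unitInterval → unitInterval) Set.univ :=
          hlip.lipschitzOnWith.comp_eVariationOn_le (Set.mapsTo_univ _ Set.univ)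
      _ = ENNReal.ofReal (dist x y) := by rw [hvar, mul_one, ← edist_nndist, edist_dist]
  · rw [← edist_dist, ← h₀, ← h₁]
    exact eVariationOn.edist_le γ (Set.mem_univ _) (Set.mem_univ _)

variable {η : X → X → unitInterval → X}

theorem dist_bicombing_le (reverse : ∀ x y t, η y x t = η x y (unitInterval.symm t))
    (dist_le : ∀ x y z t, dist (η x y t) (η x z t) ≤ t * dist y z) (x₁ x₂ y₁ y₂ : X)
    (t : unitInterval) :
    dist (η x₁ x₂ t) (η y₁ y₂ t) ≤ t * dist x₂ y₂ + (1 - t) * dist x₁ y₁ := by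
  refine (dist_triangle _ (η x₁ y₂ t) _).trans (add_le_add (dist_le _ _ _ _) ?_)
  rw [reverse y₂ x₁, reverse y₂ y₁, ← unitInterval.coe_symm_eq]
  exact dist_le _ _ _ _

/-- Contraction from a single base point suffices: `dist_triangle` through `η x₁ y₂ t` and reversal
give joint convexity, and convexity gives joint continuity. -/
theorem isGCBSpace_of_dist_le [CompleteSpace X] (zero : ∀ x y, η x y 0 = x)
    (one : ∀ x y, η x y 1 = y)
    (dist_eq : ∀ x y s t, dist (η x y s) (η x y t) = |(t : ℝ) - s| * dist x y)
    (reverse : ∀ x y t, η y x t = η x y (unitInterval.symm t))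
    (restrict : ∀ x y t s, η x (η x y t) s = η x y (t * s))
    (dist_le : ∀ x y z t, dist (η x y t) (η x z t) ≤ t * dist y z) : IsGCBSpace η where
  complete := inferInstance
  bicombing :=
    { geodesic x y := isGeodesicCurve_of_dist_eq (zero x y) (one x y) (dist_eq x y)
      reverse := reverse
      restrict := restrict
      continuous t u v x y hu hv := by
        rw [tendsto_iff_dist_tendsto_zero] at hu hv ⊢
        refine squeeze_zero (fun _ => dist_nonneg)
          (fun n => dist_bicombing_le reverse dist_le (u n) (v n) x y t) ?_
        simpa using (hv.const_mul (t : ℝ)).add (hu.const_mul (1 - (t : ℝ))) }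
  convex := dist_bicombing_le reverse dist_le

end Bicombing

section WeakOperatorTopology

variable {𝕜 E F : Type*} [RCLike 𝕜] [NormedAddCommGroup E] [NormedSpace 𝕜 E]
  [NormedAddCommGroup F] [InnerProductSpace 𝕜 F] [CompleteSpace F]

theorem exists_inner_apply_eq_of_tendsto {α : Type*} {l : Filter α} [l.NeBot] {T : α → E →L[𝕜] F}
    {M : ℝ} (hM : ∀ᶠ a in l, ‖T a‖ ≤ M) {B : E → F → 𝕜}
    (hB : ∀ v w, Tendsto (fun a => ⟪T a v, w⟫_𝕜) l (𝓝 (B v w))) :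
    ∃ S : E →L[𝕜] F, ‖S‖ ≤ M ∧ ∀ v w, ⟪S v, w⟫_𝕜 = B v w := by
  have hM₀ : 0 ≤ M := let ⟨a, ha⟩ := hM.exists; (norm_nonneg (T a)).trans ha
  let B₀ : E →ₗ⋆[𝕜] F →ₗ[𝕜] 𝕜 := LinearMap.mk₂'ₛₗ (starRingEnd 𝕜) (RingHom.id 𝕜) B
    (fun v v' w => tendsto_nhds_unique (hB _ _)
      (((hB v w).add (hB v' w)).congr fun a => by rw [map_add, inner_add_left]))
    (fun c v w => tendsto_nhds_unique (hB _ _)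
      (((hB v w).const_mul (starRingEnd 𝕜 c)).congr fun a => by rw [map_smul, inner_smul_left]))
    (fun v w w' => tendsto_nhds_unique (hB _ _)
      (((hB v w).add (hB v w')).congr fun a => by rw [inner_add_right]))
    (fun c v w => tendsto_nhds_unique (hB _ _)
      (((hB v w).const_mul c).congr fun a => by rw [inner_smul_right]))
  have hB₀ (v : E) (w : F) : ‖B₀ v w‖ ≤ M * ‖v‖ * ‖w‖ :=
    le_of_tendsto (hB v w).norm <| hM.mono fun a ha => (norm_inner_le_norm _ _).trans <|
      mul_le_mul_of_nonneg_right ((T a).le_of_opNorm_le ha v) (norm_nonneg w)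
  let toDual := InnerProductSpace.toDual 𝕜 F
  let S : E →L[𝕜] F := toDual.symm.toContinuousLinearEquiv.toContinuousLinearMap.comp
    (B₀.mkContinuous₂ M hB₀)
  have hS (v : E) (w : F) : ⟪S v, w⟫_𝕜 = B v w := InnerProductSpace.toDual_symm_apply
  refine ⟨S, S.opNorm_le_bound hM₀ fun v => ?_, hS⟩
  calc ‖S v‖ = ‖B₀.mkContinuous₂ M hB₀ v‖ := toDual.symm.norm_map _
    _ ≤ M * ‖v‖ := ContinuousLinearMap.le_of_opNorm_le _ (B₀.mkContinuous₂_norm_le hM₀ hB₀) v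

theorem isCompact_setOf_norm_toCLM_le (M : ℝ) : IsCompact {T : E →WOT[𝕜] F | ‖T.toCLM‖ ≤ M} := by
  refine isCompact_iff_ultrafilter_le_nhds.2 fun U hU => ?_
  have hM : ∀ᶠ T : E →WOT[𝕜] F in U, ‖T.toCLM‖ ≤ M := le_principal_iff.1 hU
  have hlim (v : E) (w : F) : ∃ z, Tendsto (fun T : E →WOT[𝕜] F => ⟪T.toCLM v, w⟫_𝕜) U (𝓝 z) := by
    have hball : ∀ᶠ T : E →WOT[𝕜] F in U,
        ⟪T.toCLM v, w⟫_𝕜 ∈ Metric.closedBall 0 (M * ‖v‖ * ‖w‖) := by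
      filter_upwards [hM] with T hT
      rw [mem_closedBall_zero_iff]
      grw [norm_inner_le_norm, T.toCLM.le_of_opNorm_le hT]
    obtain ⟨z, -, hz⟩ := (isCompact_closedBall _ _).ultrafilter_le_nhds
      (U.map _) (le_principal_iff.2 hball)
    exact ⟨z, hz⟩
  choose B hB using hlim
  obtain ⟨S, hSM, hS⟩ := exists_inner_apply_eq_of_tendsto hM hB
  refine ⟨.ofCLM S, hSM, ContinuousLinearMapWOT.le_nhds_iff_forall_inner_apply_le_nhds.2
    fun v w => ?_⟩
  simpa [Tendsto, Function.comp_def, ← hS] using (RCLike.continuous_conj.tendsto _).comp (hB v w)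

variable {H : Type*} [NormedAddCommGroup H] [InnerProductSpace ℂ H] [CompleteSpace H]

theorem isClosed_setOf_nonneg_toCLM : IsClosed {T : H →WOT[ℂ] H | 0 ≤ T.toCLM} := by
  simp only [ContinuousLinearMap.nonneg_iff_isPositive,
    ContinuousLinearMap.isPositive_iff_complex, Set.ofPred_forall, Set.ofPred_and]
  have hinner (v : H) : Continuous fun T : H →WOT[ℂ] H => ⟪T.toCLM v, v⟫_ℂ := by
    have hconj := Complex.continuous_conj.comp
      (ContinuousLinearMapWOT.continuous_inner_apply (𝕜 := ℂ) (f := id) continuous_id v v)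
    simpa only [Function.comp_def, inner_conj_symm, id,
      ContinuousLinearMapWOT.coe_toCLM] using hconj
  refine isClosed_iInter fun v => (isClosed_eq ?_ (hinner v)).inter (isClosed_le ?_ ?_) <;> fun_prop

theorem isClosed_setOf_toCLM_le_smul_toCLM (c : ℝ) :
    IsClosed {p : (H →WOT[ℂ] H) × (H →WOT[ℂ] H) | p.1.toCLM ≤ c • p.2.toCLM} := by
  have hsub : Continuous fun p : (H →WOT[ℂ] H) × (H →WOT[ℂ] H) => c • p.2 - p.1 := by fun_prop
  simpa [Set.preimage] using isClosed_setOf_nonneg_toCLM.preimage hsub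

end WeakOperatorTopology

namespace PosInv

variable {H : Type*} [NormedAddCommGroup H] [InnerProductSpace ℂ H] [CompleteSpace H]

/-- The point `x` of `P(H)` as an element of `B(H)` with the weak operator topology. -/
def toWOT (x : PosInv H) : H →WOT[ℂ] H := .ofCLM x.val

theorem mem_image_val_closedBall_iff {c : PosInv H} {r : ℝ} (hr : 0 ≤ r) {T : H →L[ℂ] H} :
    T ∈ val '' Metric.closedBall c r ↔ T ≤ Real.exp r • c.val ∧ c.val ≤ Real.exp r • T := by
  constructor
  · rintro ⟨x, hx, rfl⟩
    exact (dist_le_iff hr).1 hx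
  · intro h
    have hscaled : IsStrictlyPositive (Real.exp r • T) :=
      ⟨c.nonneg.trans h.2, CStarAlgebra.isUnit_of_le c.val h.2 c.isStrictlyPositive⟩
    have hT : IsStrictlyPositive T := by
      simpa [smul_smul, ← Real.exp_add] using hscaled.smul (Real.exp_pos (-r))
    exact ⟨ofIsStrictlyPositive T hT, (dist_le_iff hr).2 h, rfl⟩

theorem isClosed_toWOT_image_closedBall (c : PosInv H) {r : ℝ} (hr : 0 ≤ r) :
    IsClosed (toWOT '' Metric.closedBall c r) := by
  have himage : toWOT '' Metric.closedBall c r =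
      {T | T.toCLM ∈ val '' Metric.closedBall c r} := by
    ext T
    simp [toWOT, ← ContinuousLinearMapWOT.toCLM_injective.eq_iff]
  simp only [himage, mem_image_val_closedBall_iff hr]
  have hclosed := isClosed_setOf_toCLM_le_smul_toCLM (H := H) (Real.exp r)
  exact (hclosed.preimage (continuous_id.prodMk (continuous_const (y := c.toWOT)))).inter
    (hclosed.preimage ((continuous_const (y := c.toWOT)).prodMk continuous_id))

theorem isCompact_toWOT_image_closedBall (c : PosInv H) {r : ℝ} (hr : 0 ≤ r) :
    IsCompact (toWOT '' Metric.closedBall c r) := by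
  refine (isCompact_setOf_norm_toCLM_le ‖Real.exp r • c.val‖).of_isClosed_subset
    (isClosed_toWOT_image_closedBall c hr) ?_
  rintro _ ⟨x, hx, rfl⟩
  exact CStarAlgebra.norm_le_norm_of_nonneg_of_le x.nonneg ((dist_le_iff hr).1 hx).1

theorem exists_isWOTLimitPoint {x : ℕ → PosInv H} (hx : Bornology.IsBounded (Set.range x)) :
    ∃ z : PosInv H, IsWOTLimitPoint z.val x := by
  obtain ⟨r, hr, hball⟩ := hx.subset_closedBall_lt 0 1
  have hmem : ∀ᶠ n in atTop, (x n).toWOT ∈ toWOT '' Metric.closedBall 1 r :=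
    Eventually.of_forall fun n => Set.mem_image_of_mem toWOT (hball (Set.mem_range_self n))
  obtain ⟨_, ⟨z, -, rfl⟩, hz⟩ :=
    (isCompact_toWOT_image_closedBall 1 hr.le).exists_mapClusterPt (tendsto_principal.2 hmem)
  exact ⟨z, hz⟩

theorem IsWOTLimitPoint.exists_mem_closedBall {T : H →L[ℂ] H} {x : ℕ → PosInv H}
    (hT : IsWOTLimitPoint T x) {c : PosInv H} {r : ℝ} (hr : 0 ≤ r)
    (hx : ∀ᶠ n in atTop, dist (x n) c ≤ r) : ∃ z : PosInv H, dist z c ≤ r ∧ z.val = T := by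
  obtain ⟨z, hzc, hz⟩ := (isClosed_toWOT_image_closedBall c hr).mem_of_mapClusterPt hT
    (hx.mono fun n hn => Set.mem_image_of_mem _ hn)
  exact ⟨z, hzc, ContinuousLinearMapWOT.ofCLM_injective hz⟩

theorem IsWOTLimitPoint.dist_le {z : PosInv H} {x : ℕ → PosInv H}
    (hz : IsWOTLimitPoint z.val x) {c : PosInv H} {r : ℝ} (hr : 0 ≤ r)
    (hx : ∀ᶠ n in atTop, dist (x n) c ≤ r) : dist z c ≤ r := by
  obtain ⟨z', hz'c, hz'⟩ := hz.exists_mem_closedBall hr hx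
  exact PosInv.ext hz' ▸ hz'c

theorem IsWOTLimitPoint.isConvexClose {z : PosInv H} {x : ℕ → PosInv H}
    (hz : IsWOTLimitPoint z.val x) (hx : Bornology.IsBounded (Set.range x)) :
    IsConvexClose z (Set.range x) := by
  rintro _ ⟨m, rfl⟩
  exact hz.dist_le Metric.diam_nonneg <| Eventually.of_forall fun n =>
    Metric.dist_le_diam_of_mem hx (Set.mem_range_self n) (Set.mem_range_self m)

instance : CompleteSpace (PosInv H) := by
  refine Metric.complete_of_cauchySeq_tendsto fun x hx => ?_
  obtain ⟨z, hz⟩ := exists_isWOTLimitPoint hx.isBounded_range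
  refine ⟨z, Metric.tendsto_atTop'.2 fun ε hε => ?_⟩
  obtain ⟨N, hN⟩ := Metric.cauchySeq_iff.1 hx (ε / 2) (half_pos hε)
  refine ⟨N, fun n hn => ?_⟩
  have hzn : dist z (x n) ≤ ε / 2 := hz.dist_le (half_pos hε).le <|
    (eventually_ge_atTop N).mono fun m hm => (hN m hm n hn.le).le
  rw [dist_comm]
  exact hzn.trans_lt (half_lt_self hε)

theorem dist_le_of_mapClusterPt {α : Type*} {l : Filter α} {x y : α → PosInv H} {z w : PosInv H}
    (hzw : MapClusterPt (z.toWOT, w.toWOT) l fun a => ((x a).toWOT, (y a).toWOT))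
    {r : ℝ} (hr : 0 ≤ r) (hxy : ∀ᶠ a in l, dist (x a) (y a) ≤ r) : dist z w ≤ r := by
  simp only [dist_le_iff hr] at hxy ⊢
  exact ⟨(isClosed_setOf_toCLM_le_smul_toCLM _).mem_of_mapClusterPt hzw (hxy.mono fun _ h => h.1),
    ((isClosed_setOf_toCLM_le_smul_toCLM _).preimage continuous_swap).mem_of_mapClusterPt hzw
      (hxy.mono fun _ h => h.2)⟩

theorem IsCongruenceBy.toWOT_apply {A : H →L[ℂ] H} {f : PosInv H → PosInv H}
    (hf : IsCongruenceBy A f) (x : PosInv H) :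
    (f x).toWOT = .ofCLM (star A) * x.toWOT * .ofCLM A :=
  congrArg ContinuousLinearMapWOT.ofCLM (hf x)

theorem IsWOTLimitPoint.apply_eq_self {z : PosInv H} {x : ℕ → PosInv H}
    (hz : IsWOTLimitPoint z.val x) {f : PosInv H → PosInv H} (hf : f ∈ congruences H)
    (hxf : Tendsto (fun n => dist (x n) (f (x n))) atTop (𝓝 0)) : f z = z := by
  obtain ⟨A, hA⟩ := hf
  have hcont : Continuous fun T : H →WOT[ℂ] H =>
      (T, ContinuousLinearMapWOT.ofCLM (star A) * T * ContinuousLinearMapWOT.ofCLM A) :=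
    continuous_id.prodMk ((continuous_mul_const _).comp (continuous_const_mul _))
  have hpair : MapClusterPt (z.toWOT, (f z).toWOT) atTop
      fun n => ((x n).toWOT, (f (x n)).toWOT) := by
    simp only [hA.toWOT_apply]
    exact hz.continuousAt_comp hcont.continuousAt
  refine (dist_le_zero.1 (le_of_forall_pos_le_add fun ε hε => ?_)).symm
  rw [zero_add]
  exact dist_le_of_mapClusterPt hpair hε.le (hxf.eventually_le_const hε)

theorem isGCBSpace_eta : IsGCBSpace (eta (H := H)) :=
  isGCBSpace_of_dist_le eta_zero eta_one dist_eta_eta eta_symm eta_eta dist_eta_right_le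

theorem IsWOTLimitPoint.exists_fixed_isConvexClose {T : H →L[ℂ] H} {x : ℕ → PosInv H}
    (hT : IsWOTLimitPoint T x) (hx : Bornology.IsBounded (Set.range x))
    {F : Set (PosInv H → PosInv H)} (hF : F ⊆ congruences H)
    (hxF : ∀ f ∈ F, Tendsto (fun n => dist (x n) (f (x n))) atTop (𝓝 0)) :
    ∃ z : PosInv H, z.val = T ∧ IsConvexClose z (Set.range x) ∧ ∀ f ∈ F, f z = z := by
  obtain ⟨r, hr, hball⟩ := hx.subset_closedBall_lt 0 1
  obtain ⟨z, -, rfl⟩ := hT.exists_mem_closedBall hr.le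
    (Eventually.of_forall fun n => hball (Set.mem_range_self n))
  exact ⟨z, rfl, hT.isConvexClose hx, fun f hf => hT.apply_eq_self (hF hf) (hxF f hf)⟩

end PosInv

theorem mainTheorem8_general (H : Type*) [NormedAddCommGroup H] [InnerProductSpace ℂ H]
    [CompleteSpace H] :
    ∃ _ : MetricSpace (PosInv H),
      (∀ x y : PosInv H, dist x y = PosInv.thompsonDist x y) ∧
      IsGCBSpace (PosInv.eta (H := H)) ∧
      (∀ A : H →L[ℂ] H, IsUnit A → ∃ f : PosInv H ≃ᵢ PosInv H,
        PosInv.IsCongruenceBy A f ∧ RespectsBicombing PosInv.eta f) ∧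
      ∀ x : ℕ → PosInv H, Bornology.IsBounded (Set.range x) →
        (∃ T : H →L[ℂ] H, PosInv.IsWOTLimitPoint T x) ∧
        ∀ F ⊆ PosInv.congruences H,
          (∀ f ∈ F, Tendsto (fun n => dist (x n) (f (x n))) atTop (𝓝 0)) →
            ∀ T : H →L[ℂ] H, PosInv.IsWOTLimitPoint T x →
              ∃ z : PosInv H, z.val = T ∧ IsConvexClose z (Set.range x) ∧ ∀ f ∈ F, f z = z :=
  ⟨inferInstance, fun _ _ => rfl, PosInv.isGCBSpace_eta,
    fun _ hA => ⟨PosInv.congruenceEquiv hA.unit, fun _ => rfl,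
      fun x y t => (PosInv.eta_congruence hA.unit x y t).symm⟩,
    fun _ hx => ⟨(PosInv.exists_isWOTLimitPoint hx).imp' PosInv.val fun _ => id,
      fun _ hF hxF _ hT => hT.exists_fixed_isConvexClose hx hF hxF⟩⟩

theorem mainTheorem8 (H : Type*) [NormedAddCommGroup H] [InnerProductSpace ℂ H]
    [CompleteSpace H] :
    ∃ _ : MetricSpace (PosInv H),
      (∀ x y : PosInv H, dist x y = PosInv.thompsonDist x y) ∧
      IsGCBSpace (PosInv.eta (H := H)) ∧
      (∀ A : H →L[ℂ] H, IsUnit A → ∃ f : PosInv H ≃ᵢ PosInv H,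
        PosInv.IsCongruenceBy A f ∧ RespectsBicombing PosInv.eta f) ∧
      HasPropertyC PosInv.eta (PosInv.congruences H) ∧
      (∀ (x : ℕ → PosInv H) (F : Set (PosInv H → PosInv H)),
        IsAsymptoticallyFixed PosInv.eta (PosInv.congruences H) x F →
          (∃ T : H →L[ℂ] H, PosInv.IsWOTLimitPoint T x) ∧
          ∀ T : H →L[ℂ] H, PosInv.IsWOTLimitPoint T x →
            ∃ z : PosInv H, z.val = T ∧ IsConvexClose z (Set.range x) ∧ ∀ f ∈ F, f z = z) := by
  obtain ⟨m, hdist, hGCB, hcongr, hlim⟩ := mainTheorem8_general H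
  refine ⟨m, hdist, hGCB, hcongr, fun x F h => ?_, fun x F h =>
    ⟨(hlim x h.bounded).1, (hlim x h.bounded).2 F h.mem h.tendsto⟩⟩
  obtain ⟨⟨T, hT⟩, hfixed⟩ := hlim x h.bounded
  exact (hfixed F h.mem h.tendsto T hT).imp fun _ => And.right
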